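/- **Setting.** Let $s$ be a prime. A $s^p\times s^q$ row-column design with $n$ factors of $s$ levels (without replication) assigns to the cells of an array with $s^p$ rows and $s^q$ columns pairwise distinct level combinations $d[i,j]\in \mathrm{GF}(s)^n$. The model is $Y_{ij}=\mu+\tau_i+\rho_j+\gamma_{d[i,j]}+\varepsilon_{ij}$ with uncorrelated errors of mean zero and common variance and $$\gamma_{x}=\sum_{l}\alpha_{l,x_l}+\sum_{l<m}\sum_{v=1}^{s-1}\beta^{(v)}_{lm,\,x_l+vx_m},\qquad \sum_u\alpha_{l,u}=\sum_u\beta^{(v)}_{lm,u}=0 .$$ The main effect of $F_l$ (resp. the component $F_lF_m^v$) is *unconfounded* if all the parameters $\alpha_{l,u}$ (resp. $\beta^{(v)}_{lm,u}$) are estimable and their best linear unbiased estimators are uncorrelated with those of all estimable functions of the other parameters of the model. The two-factor interaction $F_l\times F_m$ is unconfounded if all its components are. A design is *2fi-optimal* if all its main effects are unconfounded and it has the maximum number of unconfounded two-factor interactions among all $s^p\times s^q$ row-column designs with $n$ factors all of whose main effects are unconfounded. With $N=\frac{s^{\min(p,q)}-1}{s-1}$, $\alpha=\lfloor n/N\rfloor$,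 $\beta=n-N\alpha$ and $\phi(s,p,q,n)=\binom n2-N\binom{\alpha}{2}-\alpha\beta$, the *2fi-efficiency* of a design with all main effects unconfounded is its number of unconfounded two-factor interactions divided by $\phi(s,p,q,n)$. The design generated by a matrix $\mathcal G=\binom{\mathcal G_c}{\mathcal G_r}$ over $\mathrm{GF}(s)$, with $p+q$ linearly independent rows and $n$ columns ($\mathcal G_c$ being its first $p$ rows), has $\boldsymbol x\,\mathcal G_c+\boldsymbol y\,\mathcal G_r$ in row $\boldsymbol x\in\mathrm{GF}(s)^p$ and column $\boldsymbol y\in\mathrm{GF}(s)^q$. **Theorem 8.** Let $s=2$, $3\le p\le q$ and $n=p+q+1$. Let $I_v$ be the identity matrix, $J_p$ the all-ones $p\times p$ matrix, $\boldsymbol 1_p$ the all-ones column, $K_p=(k_{ij})$ the $p\times p$ matrix with $k_{ij}=1$ if $i\le j$ and $k_{ij}=0$ otherwise, and $L_p=I_p+K_p(I_p+J_p)$, all over $\mathrm{GF}(2)$. Let $X_*$ be a $p\times(q-p)$ matrix over $\mathrm{GF}(2)$ with no zero column such that each point of $\mathrm{PG}(p-1,2)$ appears $\alpha$ or $\alpha+1$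 times among the columns of the $p\times n$ matrix $(I_p\mid I_p+J_p\mid \boldsymbol 1_p\mid X_*)$, where $\alpha=\lfloor n/(2^p-1)\rfloor$. Such a matrix $X_*$ exists, and for every such $X_*$ the matrix $$\mathcal G=\begin{pmatrix}\mathcal G_c\\ \mathcal G_r\end{pmatrix}=\begin{pmatrix} I_p & I_p+J_p & \boldsymbol 1_p & X_*\\ K_p & L_p & K_p\boldsymbol 1_p+\boldsymbol 1_p & \boldsymbol 0\\ \boldsymbol 0&\boldsymbol 0&\boldsymbol 0& I_{q-p}\end{pmatrix}$$ (with $\mathcal G_c$ its first $p$ rows) has linearly independent rows, and the design it generates is a $2^{n-1}$ fractional factorial $2^p\times 2^q$ row-column design without replication (its level combinations are, once each, the vectors of $\mathrm{GF}(2)^n$ orthogonal to one nonzero defining word), it is 2fi-optimal, and its 2fi-efficiency is $1$. -/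

import Mathlib

namespace RowColumn

/-- The cells of an array with `s ^ p` rows and `s ^ q` columns. The rows are labelled by the
vectors of `GF(s)^p` and the columns by the vectors of `GF(s)^q`. -/
abbrev Cell (s p q : ℕ) : Type := (Fin p → ZMod s) × (Fin q → ZMod s)

/-- An arrangement of level combinations of `n` factors with `s` levels in an array with `s ^ p`
rows and `s ^ q` columns, one level combination in each cell. It is without replication iff it is
injective. -/
abbrev Arrangement (s p q n : ℕ) : Type := Cell s p q → (Fin n → ZMod s)

/-- `d` is an `s ^ (n - k)` fractional factorial design without replication: the level
combinations used are, once each, those annihilated by `k` linearly independent treatment defining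
words. -/
def IsFractionalFactorial {s p q n : ℕ} (k : ℕ) (d : Arrangement s p q n) : Prop :=
  Function.Injective d ∧
    ∃ w : Fin k → (Fin n → ZMod s), LinearIndependent (ZMod s) w ∧
      Set.range d = {x | ∀ i, w i ⬝ᵥ x = 0}

/-! ### The analysis of variance model -/

/-- The parameters of the model: overall mean, row effects, column effects, main effects
`α_{l,u}` and effects `β_{lm,u}^{(v)}` of the interaction components `F_l F_m^v` (only those with
`l < m` and `v ≠ 0` occur in the model). -/
structure Params (s p q n : ℕ) [NeZero s] where
  overall : ℝ
  row : (Fin p → ZMod s) → ℝ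
  col : (Fin q → ZMod s) → ℝ
  main : Fin n → ZMod s → ℝ
  inter : Fin n → Fin n → ZMod s → ZMod s → ℝ
  main_sum : ∀ l, ∑ u, main l u = 0
  inter_sum : ∀ l m v, ∑ u, inter l m v u = 0

section Model

variable {s p q n : ℕ} [NeZero s]

/-- The effect `γ_x` of the level combination `x`. -/
def treatmentEffect (θ : Params s p q n) (x : Fin n → ZMod s) : ℝ :=
  ∑ l, θ.main l (x l) +
    ∑ l, ∑ m ∈ Finset.Ioi l, ∑ v ∈ (Finset.univ : Finset (ZMod s)).erase 0,
      θ.inter l m v (x l + v * x m)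

/-- The expectation of the observation in a cell. -/
def expectation (d : Arrangement s p q n) (θ : Params s p q n) (c : Cell s p q) : ℝ :=
  θ.overall + θ.row c.1 + θ.col c.2 + treatmentEffect θ (d c)

/-- The linear estimator `∑ c, a c * Y c` is unbiased for the function `ψ` of the parameters. -/
def IsUnbiased (d : Arrangement s p q n) (ψ : Params s p q n → ℝ) (a : Cell s p q → ℝ) : Prop :=
  ∀ θ, ∑ c, a c * expectation d θ c = ψ θ

/-- The covariance of the linear estimators `∑ c, a c * Y c` and `∑ c, b c * Y c`, in units of the
error variance: the errors are uncorrelated with mean zero and common variance. -/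
def estCov (a b : Cell s p q → ℝ) : ℝ := ∑ c, a c * b c

/-- `∑ c, a c * Y c` is the best (minimum variance) linear unbiased estimator, that is the least
squares estimator, of `ψ`. -/
def IsBLUE (d : Arrangement s p q n) (ψ : Params s p q n → ℝ) (a : Cell s p q → ℝ) : Prop :=
  IsUnbiased d ψ a ∧ ∀ b, IsUnbiased d ψ b → estCov a a ≤ estCov b b

/-- The effect with parameters `ψ u` (`u` a level) is unconfounded: all its parameters have
estimators, and these are uncorrelated with the estimator of every estimable function of the other
parameters. `SameOthers θ θ'` says that `θ` and `θ'` differ at most in the parameters of the effect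
under consideration. -/
def IsUnconfounded (d : Arrangement s p q n) (ψ : ZMod s → Params s p q n → ℝ)
    (SameOthers : Params s p q n → Params s p q n → Prop) : Prop :=
  ∀ u, ∃ a, IsBLUE d (ψ u) a ∧
    ∀ (χ : Params s p q n → ℝ) (b : Cell s p q → ℝ),
      (∀ θ θ', SameOthers θ θ' → χ θ = χ θ') → IsBLUE d χ b → estCov a b = 0

/-- The main effect of `F_l` is unconfounded. -/
def MainUnconfounded (d : Arrangement s p q n) (l : Fin n) : Prop :=
  IsUnconfounded d (fun u θ => θ.main l u) fun θ θ' =>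
    θ.overall = θ'.overall ∧ θ.row = θ'.row ∧ θ.col = θ'.col ∧
      (∀ l', l' ≠ l → θ.main l' = θ'.main l') ∧ θ.inter = θ'.inter

/-- The interaction component `F_l F_m^v` is unconfounded. -/
def ComponentUnconfounded (d : Arrangement s p q n) (l m : Fin n) (v : ZMod s) : Prop :=
  IsUnconfounded d (fun u θ => θ.inter l m v u) fun θ θ' =>
    θ.overall = θ'.overall ∧ θ.row = θ'.row ∧ θ.col = θ'.col ∧ θ.main = θ'.main ∧
      ∀ l' m' v', (l', m', v') ≠ (l, m, v) → θ.inter l' m' v' = θ'.inter l' m' v'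

/-- The two-factor interaction `F_l × F_m` (for `l < m`) is unconfounded. -/
def InteractionUnconfounded (d : Arrangement s p q n) (l m : Fin n) : Prop :=
  ∀ v : ZMod s, v ≠ 0 → ComponentUnconfounded d l m v

/-- The number of unconfounded two-factor interactions. -/
noncomputable def numUnconfounded (d : Arrangement s p q n) : ℕ :=
  {e : Fin n × Fin n | e.1 < e.2 ∧ InteractionUnconfounded d e.1 e.2}.ncard

/-- 2fi-optimality: all main effects are unconfounded, and the number of unconfounded two-factor
interactions is the largest possible among all arrangements without replication, with the same
parameters, in which all main effects are unconfounded. -/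
def IsTwoFiOptimal (d : Arrangement s p q n) : Prop :=
  Function.Injective d ∧ (∀ l, MainUnconfounded d l) ∧
    ∀ d' : Arrangement s p q n, Function.Injective d' → (∀ l, MainUnconfounded d' l) →
      numUnconfounded d' ≤ numUnconfounded d

/-- The bound `φ(s,p,q,n) = C(n,2) - N C(α,2) - α β`, where `N = (s^min(p,q) - 1) / (s - 1)`
(an integer), `α = ⌊n / N⌋` and `β = n - N α`. -/
def phi (s p q n : ℕ) : ℚ :=
  let N : ℕ := (s ^ min p q - 1) / (s - 1)
  let α : ℕ := n / N
  let β : ℚ := (n : ℚ) - N * α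
  (n.choose 2 : ℚ) - N * (α.choose 2 : ℚ) - α * β

/-- The 2fi-efficiency (of a design with all main effects unconfounded). -/
noncomputable def twoFiEfficiency (d : Arrangement s p q n) : ℚ :=
  (numUnconfounded d : ℚ) / phi s p q n

end Model

/-- The arrangement constructed from the array generator matrix with upper part `Gc` and lower part
`Gr`: the column key block is the row space of `Gc`, the row key block is the row space of `Gr`,
and the cell in row `x` and column `y` contains the sum of the corresponding vectors. -/
def generatedBy {s p q n : ℕ} (G : Matrix (Fin p ⊕ Fin q) (Fin n) (ZMod s)) :
    Arrangement s p q n :=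
  fun c => Matrix.vecMul c.1 G.toRows₁ + Matrix.vecMul c.2 G.toRows₂

/-! ### The two-level construction -/

/-- The number of columns of `M` that belong to the point `P` of `PG(p-1,s)`. -/
noncomputable def pointCount {s p : ℕ} [Fact s.Prime] {ι : Type} (M : Matrix (Fin p) ι (ZMod s))
    (P : Projectivization (ZMod s) (Fin p → ZMod s)) : ℕ :=
  {j : ι | Submodule.span (ZMod s) {M.col j} = P.submodule}.ncard

/-- The all-ones square matrix. -/
def J (p : ℕ) : Matrix (Fin p) (Fin p) (ZMod 2) := Matrix.of fun _ _ => 1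

/-- The all-ones column. -/
def ones (p : ℕ) : Matrix (Fin p) (Fin 1) (ZMod 2) := Matrix.of fun _ _ => 1

/-- Ones on and above the diagonal, zeros below. -/
def K (p : ℕ) : Matrix (Fin p) (Fin p) (ZMod 2) := Matrix.of fun i j => if i ≤ j then 1 else 0

def L (p : ℕ) : Matrix (Fin p) (Fin p) (ZMod 2) := 1 + K p * (1 + J p)

/-- The four blocks of columns. -/
abbrev ColIdx (p q : ℕ) : Type := ((Fin p ⊕ Fin p) ⊕ Fin 1) ⊕ Fin (q - p)

/-- The upper part `(I | I + J | 1 | X)`. -/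
def upperPart (p q : ℕ) (X : Matrix (Fin p) (Fin (q - p)) (ZMod 2)) :
    Matrix (Fin p) (ColIdx p q) (ZMod 2) :=
  (((1 : Matrix (Fin p) (Fin p) (ZMod 2)).fromCols (1 + J p)).fromCols (ones p)).fromCols X

/-- The lower part, with block rows `(K | L | K 1 + 1 | 0)` and `(0 | 0 | 0 | I)`. -/
def lowerPart (p q : ℕ) : Matrix (Fin p ⊕ Fin (q - p)) (ColIdx p q) (ZMod 2) :=
  Matrix.fromBlocks (((K p).fromCols (L p)).fromCols (K p * ones p + ones p)) 0 0 1

/-- The blocks of columns, numbered consecutively from left to right. -/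
def colEquiv {p q n : ℕ} (hpq : p ≤ q) (hn : n = p + q + 1) : ColIdx p q ≃ Fin n :=
  ((((finSumFinEquiv.sumCongr (Equiv.refl _)).trans finSumFinEquiv).sumCongr
    (Equiv.refl _)).trans finSumFinEquiv).trans (finCongr (by omega))

/-- The blocks of rows of the lower part, numbered consecutively from top to bottom. -/
def rowEquiv {p q : ℕ} (hpq : p ≤ q) : Fin p ⊕ Fin (q - p) ≃ Fin q :=
  finSumFinEquiv.trans (finCongr (by omega))

/-- The array generator matrix of the construction. -/
def generator {p q n : ℕ} (hpq : p ≤ q) (hn : n = p + q + 1)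
    (X : Matrix (Fin p) (Fin (q - p)) (ZMod 2)) :
    Matrix (Fin p ⊕ Fin q) (Fin n) (ZMod 2) :=
  ((upperPart p q X).fromRows (lowerPart p q)).reindex
    ((Equiv.refl _).sumCongr (rowEquiv hpq)) (colEquiv hpq hn)

/-- The requirement on the block `X`: its columns are nonzero, and every point of `PG(p-1,2)`
appears `α` or `α + 1` times in `(I | I + J | 1 | X)`, where `α = ⌊n / (2^p - 1)⌋`. -/
def IsAdmissible (p q n : ℕ) (X : Matrix (Fin p) (Fin (q - p)) (ZMod 2)) : Prop :=
  (∀ j, X.col j ≠ 0) ∧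
    ∀ P : Projectivization (ZMod 2) (Fin p → ZMod 2),
      pointCount (upperPart p q X) P = n / (2 ^ p - 1) ∨
        pointCount (upperPart p q X) P = n / (2 ^ p - 1) + 1

end RowColumn

/-! ### Two-level effects as multiples of a single sign contrast. -/

namespace RowColumn

/-! At two levels every effect has one degree of freedom, hence a single contrast vector with
entries ±1, and being unconfounded amounts to orthogonality of this vector to the rest of the model
(`isUnconfounded_of_orthogonal`, `orthogonal_of_isUnconfounded`).

Upper bound: restrict any competing design to one array column. The main contrasts sum to zero
there, and an unconfounded interaction makes two restricted main contrasts orthogonal. A clique of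
such pairs, together with the constant vector, is an orthogonal family in dimension `2 ^ p`, so
cliques have at most `2 ^ p - 1` vertices and Turán's theorem gives `φ` (`numUnconfounded_le_phi`).

Attainment: in a linear design all contrasts are characters of the group of cells. If any four
generator columns are independent (`fourIndependent_generator`), treatment contrasts are mutually
orthogonal, and only rows and columns of the array can confound. The lower generator columns are
nonzero and distinct, the upper ones nonzero, so an interaction is unconfounded as soon as its two
upper columns differ. Admissibility spreads the upper columns evenly over the points, which makes
the number of such pairs equal to `φ` (`phi_le_numUnconfounded_generator`). -/

lemma zmod_two_cases (a : ZMod 2) : a = 0 ∨ a = 1 := by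
  revert a; decide

/-- The nontrivial real character of `ZMod 2`. -/
def sgn (a : ZMod 2) : ℝ := if a = 0 then 1 else -1

lemma sgn_add (a b : ZMod 2) : sgn (a + b) = sgn a * sgn b := by
  have h : (1 + 1 : ZMod 2) = 0 := by decide
  rcases zmod_two_cases a with rfl | rfl <;> rcases zmod_two_cases b with rfl | rfl <;>
    simp [sgn, h]

@[simp] lemma sgn_zero : sgn 0 = 1 := by simp [sgn]

@[simp] lemma sgn_one : sgn 1 = -1 := by simp [sgn]

lemma sgn_mul_self (a : ZMod 2) : sgn a * sgn a = 1 := by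
  unfold sgn; split <;> norm_num

lemma sum_sgn : ∑ u, sgn u = 0 := by
  have : (Finset.univ : Finset (ZMod 2)) = {0, 1} := by decide
  rw [this]; simp

/-- The zero-sum constraint leaves one free parameter per effect, namely its value at level 0. -/
lemma eq_mul_sgn {f : ZMod 2 → ℝ} (hf : ∑ u, f u = 0) (u : ZMod 2) : f u = f 0 * sgn u := by
  have h : (Finset.univ : Finset (ZMod 2)) = {0, 1} := by decide
  rw [h, Finset.sum_pair (by decide)] at hf
  rcases zmod_two_cases u with rfl | rfl
  · simp
  · rw [sgn_one]
    linarith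

/-! ### Unconfoundedness and orthogonality of contrast vectors. -/

section Unconfounded

variable {p q n : ℕ} {d : Arrangement 2 p q n} {ψ : ZMod 2 → Params 2 p q n → ℝ}
  {SameOthers : Params 2 p q n → Params 2 p q n → Prop}

/-- A contrast vector that is orthogonal to the rest of the model gives an unconfounded effect. -/
lemma isUnconfounded_of_orthogonal (x : Cell 2 p q → ℝ) (hx : estCov x x ≠ 0)
    (hψ : ∀ u θ, ψ u θ = ψ 0 θ * sgn u)
    (horth : ∀ θ, ∑ c, x c * expectation d θ c = ψ 0 θ * estCov x x)
    (h1 : ∃ θ θ', SameOthers θ θ' ∧ ψ 0 θ = 1 ∧ expectation d θ = x ∧ expectation d θ' = 0) :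
    IsUnconfounded d ψ SameOthers := by
  obtain ⟨θ₁, θ₀, hS, hθ₁, hE₁, hE₀⟩ := h1
  intro u
  have key : ∀ b : Cell 2 p q → ℝ, estCov (fun c => sgn u / estCov x x * x c) b =
      sgn u / estCov x x * ∑ c, b c * x c := by
    intro b
    rw [Finset.mul_sum]
    exact Finset.sum_congr rfl fun c _ => by ring
  refine ⟨fun c => sgn u / estCov x x * x c, ⟨?_, ?_⟩, ?_⟩
  · intro θ
    simp only [mul_assoc]
    rw [← Finset.mul_sum, horth, hψ u θ]
    field_simp
  · intro b hb
    -- Unbiasedness at `θ₁` fixes the inner product of `b` with `x`, hence `estCov a b = estCov a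
    -- a`; then `‖b - a‖² ≥ 0` is minimality.
    have hbx := hb θ₁
    rw [hE₁, hψ, hθ₁, one_mul] at hbx
    have hab := key b
    rw [hbx] at hab
    have haa := key fun c => sgn u / estCov x x * x c
    have hxx : ∑ c, sgn u / estCov x x * x c * x c = sgn u := by
      simp only [mul_assoc]
      rw [← Finset.mul_sum]
      change _ * estCov x x = _
      field_simp
    rw [hxx] at haa
    set a : Cell 2 p q → ℝ := fun c => sgn u / estCov x x * x c
    have hpos : 0 ≤ ∑ c, (b c - a c) ^ 2 := Finset.sum_nonneg fun c _ => sq_nonneg _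
    have hexp : ∑ c, (b c - a c) ^ 2 = estCov b b - 2 * estCov a b + estCov a a := by
      simp only [estCov]
      rw [Finset.mul_sum, ← Finset.sum_sub_distrib, ← Finset.sum_add_distrib]
      exact Finset.sum_congr rfl fun c _ => by ring
    linarith
  · intro χ b hχ hb
    rw [key]
    -- `χ` cannot distinguish `θ₁` from `θ₀`, while their expectations are `x` and `0`; so `b` is
    -- orthogonal to `x`.
    have e₁ := hb.1 θ₁
    have e₀ := hb.1 θ₀
    rw [hE₁] at e₁
    rw [hE₀] at e₀
    rw [e₁, hχ _ _ hS, ← e₀]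
    simp

/-- The contrast vector of an unconfounded effect is orthogonal to every other vector of the
model. -/
lemma orthogonal_of_isUnconfounded (x w : Cell 2 p q → ℝ) (hx : estCov x x ≠ 0)
    (hS : ∀ θ θ', SameOthers θ θ' → ∃ t : ℝ, ∀ c, expectation d θ c = expectation d θ' c + t * x c)
    (hw : ∀ t : ℝ, ∃ θ, ψ 0 θ = t ∧ ∀ c, expectation d θ c = w c + t * x c)
    (h : IsUnconfounded d ψ SameOthers) : estCov w x = 0 := by
  obtain ⟨a, ha, hcov⟩ := h 0
  have haw : estCov a w = 0 := by
    obtain ⟨θ, hθ, hE⟩ := hw 0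
    have := ha.1 θ
    simp only [hE, hθ, zero_mul, add_zero] at this
    exact this
  have hax : estCov a x = 1 := by
    obtain ⟨θ, hθ, hE⟩ := hw 1
    have := ha.1 θ
    simp only [hE, hθ, one_mul, mul_add, Finset.sum_add_distrib] at this
    change estCov a w + estCov a x = 1 at this
    linarith
  -- `b = w - t x` removes from `w` its projection onto `x`. As `a` pairs to 0 with `w` and to 1
  -- with `x`, it pairs to `-t` with `b`.
  set t := estCov w x / estCov x x with ht
  obtain ⟨θ, -, hE⟩ := hw (-t)
  set b : Cell 2 p q → ℝ := expectation d θ with hb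
  have hbx : ∑ c, b c * x c = 0 := by
    simp only [hE, add_mul, Finset.sum_add_distrib, mul_assoc]
    rw [← Finset.mul_sum]
    change estCov w x + -t * estCov x x = 0
    rw [ht]; field_simp; ring
  -- Being an expectation vector, `b` is the best estimator of its own expected value; being
  -- orthogonal to `x`, it estimates a function of the other parameters only.
  have h0 : estCov a b = 0 := by
    refine hcov (fun θ' => ∑ c, b c * expectation d θ' c) b ?_ ⟨fun θ' => rfl, ?_⟩
    · intro θ₁ θ₂ h12
      obtain ⟨r, hr⟩ := hS _ _ h12
      simp only [hr, mul_add, Finset.sum_add_distrib, mul_left_comm _ r]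
      rw [← Finset.mul_sum, hbx]
      simp
    · intro b' hb'
      have := hb' θ
      rw [← hb] at this
      have hpos : 0 ≤ ∑ c, (b' c - b c) ^ 2 := Finset.sum_nonneg fun c _ => sq_nonneg _
      have hexp : ∑ c, (b' c - b c) ^ 2 =
          estCov b' b' - 2 * (∑ c, b' c * b c) + estCov b b := by
        simp only [estCov]
        rw [Finset.mul_sum, ← Finset.sum_sub_distrib, ← Finset.sum_add_distrib]
        exact Finset.sum_congr rfl fun c _ => by ring
      change _ = estCov b b at this
      linarith
  have h1 : estCov a b = estCov a w + -t * estCov a x := by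
    simp only [estCov, hE]
    rw [Finset.mul_sum, ← Finset.sum_add_distrib]
    exact Finset.sum_congr rfl fun c _ => by ring
  rw [h0, haw, hax, ht] at h1
  have h2 : estCov w x / estCov x x = 0 := by linarith
  exact (div_eq_zero_iff.mp h2).resolve_right hx

end Unconfounded

/-! ### The model in terms of contrast vectors. -/

section Contrasts

variable {p q n : ℕ} (d : Arrangement 2 p q n)

/-- The contrast vector of the main effect of `F_l`. -/
def mainContrast (l : Fin n) (c : Cell 2 p q) : ℝ := sgn (d c l)

/-- The contrast vector of the interaction of `F_l` and `F_m`. -/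
def interContrast (l m : Fin n) (c : Cell 2 p q) : ℝ := sgn (d c l + d c m)

lemma estCov_sgn_ne_zero (f : Cell 2 p q → ZMod 2) :
    estCov (fun c => sgn (f c)) (fun c => sgn (f c)) ≠ 0 := by
  simp [estCov, sgn_mul_self]

lemma expectation_eq (θ : Params 2 p q n) (c : Cell 2 p q) :
    expectation d θ c = θ.overall + θ.row c.1 + θ.col c.2 +
      (∑ l, θ.main l 0 * mainContrast d l c +
        ∑ l, ∑ m ∈ Finset.Ioi l, θ.inter l m 1 0 * interContrast d l m c) := by
  have h1 : (Finset.univ : Finset (ZMod 2)).erase 0 = {1} := by decide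
  unfold expectation treatmentEffect mainContrast interContrast
  simp only [h1, Finset.sum_singleton, one_mul]
  congr 2
  · exact Finset.sum_congr rfl fun l _ => eq_mul_sgn (θ.main_sum l) _
  · exact Finset.sum_congr rfl fun l _ => Finset.sum_congr rfl fun m _ =>
      eq_mul_sgn (θ.inter_sum l m 1) _

/-- Parameters with prescribed effects. -/
def mkParams (col : (Fin q → ZMod 2) → ℝ) (main : Fin n → ℝ) (inter : Fin n → Fin n → ℝ) :
    Params 2 p q n where
  overall := 0
  row := 0
  col := col
  main l u := main l * sgn u
  inter l m v u := if v = 1 then inter l m * sgn u else 0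
  main_sum l := by rw [← Finset.mul_sum, sum_sgn, mul_zero]
  inter_sum l m v := by
    split
    · rw [← Finset.mul_sum, sum_sgn, mul_zero]
    · simp

lemma expectation_mkParams (col : (Fin q → ZMod 2) → ℝ) (main : Fin n → ℝ)
    (inter : Fin n → Fin n → ℝ) (c : Cell 2 p q) :
    expectation d (mkParams col main inter) c = col c.2 +
      (∑ l, main l * mainContrast d l c +
        ∑ l, ∑ m ∈ Finset.Ioi l, inter l m * interContrast d l m c) := by
  rw [expectation_eq]
  simp [mkParams]

lemma sum_Ioi_single {l m : Fin n} (hlm : l < m) (t : ℝ) (f : Fin n → Fin n → ℝ) :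
    ∑ l', ∑ m' ∈ Finset.Ioi l', (if (l', m') = (l, m) then t else 0) * f l' m' = t * f l m := by
  rw [Finset.sum_eq_single l]
  · rw [Finset.sum_eq_single m]
    · simp
    · intro b _ hb
      simp [hb]
    · intro h
      exact absurd (Finset.mem_Ioi.mpr hlm) h
  · intro b _ hb
    exact Finset.sum_eq_zero fun m' _ => by simp [hb]
  · simp

variable {d}

/-- The model space is spanned by row functions, column functions and contrasts, so these
orthogonalities leave one term in the pairing with the contrast. -/
lemma mainUnconfounded_of_orthogonal {l : Fin n}
    (hrow : ∀ f : (Fin p → ZMod 2) → ℝ, ∑ c, mainContrast d l c * f c.1 = 0)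
    (hcol : ∀ f : (Fin q → ZMod 2) → ℝ, ∑ c, mainContrast d l c * f c.2 = 0)
    (hmain : ∀ l', l' ≠ l → ∑ c, mainContrast d l c * mainContrast d l' c = 0)
    (hint : ∀ j k, j < k → ∑ c, mainContrast d l c * interContrast d j k c = 0) :
    MainUnconfounded d l := by
  refine isUnconfounded_of_orthogonal (mainContrast d l) (estCov_sgn_ne_zero _)
    (fun u θ => eq_mul_sgn (θ.main_sum l) u) ?_ ?_
  · intro θ
    simp only [expectation_eq, mul_add, Finset.sum_add_distrib, Finset.mul_sum]
    -- The overall mean is treated as a constant row effect.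
    rw [hrow fun _ => θ.overall, hrow, hcol, Finset.sum_comm]
    have e1 : ∑ c, ∑ j, ∑ k ∈ Finset.Ioi j,
        mainContrast d l c * (θ.inter j k 1 0 * interContrast d j k c) = 0 := by
      rw [Finset.sum_comm]
      refine Finset.sum_eq_zero fun j _ => ?_
      rw [Finset.sum_comm]
      refine Finset.sum_eq_zero fun k hk => ?_
      simp only [mul_left_comm _ (θ.inter j k 1 0)]
      rw [← Finset.mul_sum, hint j k (Finset.mem_Ioi.mp hk), mul_zero]
    rw [e1, Finset.sum_eq_single l]
    · simp only [mul_left_comm _ (θ.main l 0)]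
      rw [← Finset.mul_sum]
      simp [estCov]
    · intro l' _ hl'
      simp only [mul_left_comm _ (θ.main l' 0)]
      rw [← Finset.mul_sum, hmain l' hl', mul_zero]
    · simp
  · refine ⟨mkParams 0 (Pi.single l 1) 0, mkParams 0 0 0, ⟨rfl, rfl, rfl, ?_, rfl⟩, ?_, ?_, ?_⟩
    · intro l' hl'
      ext u
      simp [mkParams, hl']
    · simp [mkParams]
    · ext c
      simp [expectation_mkParams, Pi.single_apply]
    · ext c
      simp [expectation_mkParams]

lemma interactionUnconfounded_of_orthogonal {l m : Fin n} (hlm : l < m)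
    (hrow : ∀ f : (Fin p → ZMod 2) → ℝ, ∑ c, interContrast d l m c * f c.1 = 0)
    (hcol : ∀ f : (Fin q → ZMod 2) → ℝ, ∑ c, interContrast d l m c * f c.2 = 0)
    (hmain : ∀ l', ∑ c, interContrast d l m c * mainContrast d l' c = 0)
    (hint : ∀ j k, j < k → (j, k) ≠ (l, m) →
      ∑ c, interContrast d l m c * interContrast d j k c = 0) :
    InteractionUnconfounded d l m := by
  intro v hv
  obtain rfl : v = 1 := (zmod_two_cases v).resolve_left hv
  refine isUnconfounded_of_orthogonal (interContrast d l m) (estCov_sgn_ne_zero _)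
    (fun u θ => eq_mul_sgn (θ.inter_sum l m 1) u) ?_ ?_
  · intro θ
    simp only [expectation_eq, mul_add, Finset.sum_add_distrib, Finset.mul_sum]
    rw [hrow fun _ => θ.overall, hrow, hcol, Finset.sum_comm]
    have e1 : ∑ l', ∑ c, interContrast d l m c * (θ.main l' 0 * mainContrast d l' c) = 0 := by
      refine Finset.sum_eq_zero fun j _ => ?_
      simp only [mul_left_comm _ (θ.main j 0)]
      rw [← Finset.mul_sum, hmain j, mul_zero]
    rw [e1, Finset.sum_comm, Finset.sum_eq_single l]
    · rw [Finset.sum_comm, Finset.sum_eq_single m]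
      · simp only [mul_left_comm _ (θ.inter l m 1 0)]
        rw [← Finset.mul_sum]
        simp [estCov]
      · intro k hk hkm
        simp only [mul_left_comm _ (θ.inter l k 1 0)]
        rw [← Finset.mul_sum, hint l k (Finset.mem_Ioi.mp hk) (by simp [hkm]), mul_zero]
      · intro h
        exact absurd (Finset.mem_Ioi.mpr hlm) h
    · intro j _ hj
      rw [Finset.sum_comm]
      refine Finset.sum_eq_zero fun k hk => ?_
      simp only [mul_left_comm _ (θ.inter j k 1 0)]
      rw [← Finset.mul_sum, hint j k (Finset.mem_Ioi.mp hk) (by simp [hj]), mul_zero]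
    · simp
  · refine ⟨mkParams 0 0 fun l' m' => if (l', m') = (l, m) then 1 else 0, mkParams 0 0 0,
      ⟨rfl, rfl, rfl, rfl, ?_⟩, ?_, ?_, ?_⟩
    · intro l' m' v' h
      ext u
      by_cases h1 : v' = 1
      · have : ¬ (l' = l ∧ m' = m) := by
          rintro ⟨rfl, rfl⟩
          exact h (by rw [h1])
        simp [mkParams, this]
      · simp [mkParams, h1]
    · simp [mkParams]
    · ext c
      rw [expectation_mkParams, sum_Ioi_single hlm]
      simp
    · ext c
      simp [expectation_mkParams]

/-- The indicator of a single array column is a column effect, hence a model vector orthogonal to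
the contrast. -/
lemma MainUnconfounded.sum_column_eq_zero {l : Fin n} (h : MainUnconfounded d l)
    (y : Fin q → ZMod 2) : ∑ x, mainContrast d l (x, y) = 0 := by
  have key : estCov (fun c : Cell 2 p q => if c.2 = y then (1 : ℝ) else 0) (mainContrast d l) = 0 := by
    refine orthogonal_of_isUnconfounded _ _ (estCov_sgn_ne_zero _) ?_ ?_ h
    · rintro θ θ' ⟨h1, h2, h3, h4, h5⟩
      refine ⟨θ.main l 0 - θ'.main l 0, fun c => ?_⟩
      rw [expectation_eq, expectation_eq, h1, h2, h3, h5,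
        ← Finset.add_sum_erase _ _ (Finset.mem_univ l),
        ← Finset.add_sum_erase _ (fun l' => θ'.main l' 0 * _) (Finset.mem_univ l),
        Finset.sum_congr rfl fun l' hl' => by rw [h4 l' (Finset.ne_of_mem_erase hl')]]
      ring
    · intro t
      refine ⟨mkParams (fun y' => if y' = y then 1 else 0) (Pi.single l t) 0, ?_, ?_⟩
      · simp [mkParams]
      · intro c
        simp [expectation_mkParams, Pi.single_apply]
  simp only [estCov, Fintype.sum_prod_type_right] at key
  rw [Finset.sum_eq_single y] at key
  · simpa using key
  · intro y' _ hy'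
    simp [hy']
  · simp

lemma InteractionUnconfounded.sum_column_eq_zero {l m : Fin n} (hlm : l < m)
    (h : InteractionUnconfounded d l m) (y : Fin q → ZMod 2) :
    ∑ x, interContrast d l m (x, y) = 0 := by
  have key : estCov (fun c : Cell 2 p q => if c.2 = y then (1 : ℝ) else 0)
      (interContrast d l m) = 0 := by
    refine orthogonal_of_isUnconfounded _ _ (estCov_sgn_ne_zero _) ?_ ?_ (h 1 (by decide))
    · rintro θ θ' ⟨h1, h2, h3, h4, h5⟩
      refine ⟨θ.inter l m 1 0 - θ'.inter l m 1 0, fun c => ?_⟩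
      have e : ∑ j, ∑ k ∈ Finset.Ioi j, θ.inter j k 1 0 * interContrast d j k c =
          ∑ j, ∑ k ∈ Finset.Ioi j, θ'.inter j k 1 0 * interContrast d j k c +
            (θ.inter l m 1 0 - θ'.inter l m 1 0) * interContrast d l m c := by
        rw [← sum_Ioi_single hlm _ fun j k => interContrast d j k c, ← Finset.sum_add_distrib]
        refine Finset.sum_congr rfl fun j _ => ?_
        rw [← Finset.sum_add_distrib]
        refine Finset.sum_congr rfl fun k _ => ?_
        by_cases hjk : (j, k) = (l, m)
        · obtain ⟨rfl, rfl⟩ := Prod.mk.inj hjk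
          simp
          ring
        · rw [h5 j k 1 (by intro h'; apply hjk; simp_all), if_neg hjk]
          ring
      rw [expectation_eq, expectation_eq, h1, h2, h3, h4, e]
      ring
    · intro t
      refine ⟨mkParams (fun y' => if y' = y then 1 else 0) 0
        fun l' m' => if (l', m') = (l, m) then t else 0, ?_, ?_⟩
      · simp [mkParams]
      · intro c
        rw [expectation_mkParams, sum_Ioi_single hlm]
        simp
  simp only [estCov, Fintype.sum_prod_type_right] at key
  rw [Finset.sum_eq_single y] at key
  · simpa using key
  · intro y' _ hy'
    simp [hy']
  · simp

end Contrasts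

/-! ### The Turán bound on unconfounded interactions. -/

section UpperBound

lemma phi_two_eq {p q : ℕ} (hpq : p ≤ q) (n : ℕ) :
    phi 2 p q n = (n.choose 2 : ℚ) - (2 ^ p - 1 : ℕ) * ((n / (2 ^ p - 1)).choose 2 : ℚ) -
      (n / (2 ^ p - 1) : ℕ) * ((n : ℚ) - (2 ^ p - 1 : ℕ) * (n / (2 ^ p - 1) : ℕ)) := by
  simp [phi, min_eq_left hpq]

lemma cast_choose_two_eq (a : ℕ) : (a.choose 2 : ℚ) = a * (a - 1) / 2 := Nat.cast_choose_two ℚ a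

/-- This shape matches the fibre count for the construction, where squares of multiplicities are
replaced by linear expressions. -/
lemma two_mul_phi_two {p q : ℕ} (hpq : p ≤ q) (n : ℕ) :
    2 * phi 2 p q n = (n : ℚ) ^ 2 - ((2 * (n / (2 ^ p - 1) : ℕ) + 1) * n -
      (2 ^ p - 1 : ℕ) * ((n / (2 ^ p - 1) : ℕ) * ((n / (2 ^ p - 1) : ℕ) + 1))) := by
  rw [phi_two_eq hpq, cast_choose_two_eq, cast_choose_two_eq]
  ring

/-- Turán's bound in the form that counts the pairs inside the parts. -/
lemma card_edgeFinset_le_of_cliqueFree {n N : ℕ} (hN : 0 < N) (G : SimpleGraph (Fin n))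
    [DecidableRel G.Adj] (h : G.CliqueFree (N + 1)) :
    (G.edgeFinset.card : ℚ) ≤ (n.choose 2 : ℚ) - N * ((n / N).choose 2 : ℚ) -
      (n / N : ℕ) * ((n : ℚ) - N * (n / N : ℕ)) := by
  have h1 := h.card_edgeFinset_le
  simp only [Fintype.card_fin] at h1
  obtain ⟨M, rfl⟩ : ∃ M, N = M + 1 := ⟨N - 1, by omega⟩
  have hn := Nat.div_add_mod n (M + 1)
  set α := n / (M + 1)
  set β := n % (M + 1)
  have hnQ : (n : ℚ) = (M + 1) * α + β := by exact_mod_cast hn.symm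
  have hle : n ^ 2 - β ^ 2 = (M + 1) * (α * ((M + 1) * α + 2 * β)) := by
    rw [← hn]
    apply Nat.sub_eq_of_eq_add
    ring
  rw [hle, Nat.add_sub_cancel, mul_comm 2 (M + 1), mul_assoc, Nat.mul_div_mul_left _ _ hN] at h1
  -- Replacing the floor in Turán's number by the rational quotient only weakens the bound, and the
  -- rational expression equals the claimed one exactly.
  have h2 : (G.edgeFinset.card : ℚ) ≤
      (α * ((M + 1) * α + 2 * β) * M : ℚ) / 2 + (β.choose 2 : ℚ) := by
    calc (G.edgeFinset.card : ℚ)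
        ≤ ((α * ((M + 1) * α + 2 * β) * M / 2 + β.choose 2 : ℕ) : ℚ) := by exact_mod_cast h1
      _ ≤ _ := by
        push_cast
        gcongr
        exact Nat.cast_div_le.trans (by push_cast; rfl)
  refine h2.trans (le_of_eq ?_)
  rw [cast_choose_two_eq, cast_choose_two_eq, cast_choose_two_eq, hnQ]
  push_cast
  ring

variable {X : Type*} [Fintype X] {n : ℕ}

/-- Two factors are joined if their contrasts are orthogonal. -/
def orthGraph [Nonempty X] (f : X → Fin n → ZMod 2) : SimpleGraph (Fin n) where
  Adj l m := ∑ x, sgn (f x l + f x m) = 0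
  symm := ⟨fun l m h => by simpa only [add_comm] using h⟩
  loopless := ⟨fun l h => by
    simp only [sgn_add, sgn_mul_self] at h
    simp at h⟩

/-- A clique with `|X|` vertices and the constant vector would be `|X| + 1` nonzero orthogonal
vectors in `ℝ^X`. -/
lemma orthGraph_cliqueFree [Nonempty X] (f : X → Fin n → ZMod 2)
    (hf : ∀ l, ∑ x, sgn (f x l) = 0) : (orthGraph f).CliqueFree (Fintype.card X) := by
  intro S hS
  have hcard := hS.card_eq
  have hcl := hS.isClique
  -- `none` carries the constant vector.
  let v : Option S → EuclideanSpace ℝ X := fun o =>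
    WithLp.toLp 2 (fun x => o.elim 1 fun l => sgn (f x l))
  have hv : LinearIndependent ℝ v := by
    apply linearIndependent_of_ne_zero_of_inner_eq_zero
    · intro o h
      obtain ⟨x⟩ := ‹Nonempty X›
      have hx : v o x = 0 := by rw [h]; rfl
      cases o with
      | none => simp [v] at hx
      | some l =>
        have := sgn_mul_self (f x l)
        simp only [v, Option.elim_some] at hx
        simp [hx] at this
    · intro o o' hoo
      cases o with
      | none =>
        cases o' with
        | none => exact absurd rfl hoo
        | some m => simpa [v, PiLp.inner_apply] using hf m
      | some l =>
        cases o' with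
        | none => simpa [v, PiLp.inner_apply] using hf l
        | some m =>
          have : (l : Fin n) ≠ m := fun h => hoo (by rw [Subtype.ext h])
          have h := hcl l.2 m.2 this
          change ∑ x, sgn (f x l + f x m) = 0 at h
          simp only [sgn_add] at h
          simpa [v, PiLp.inner_apply, mul_comm] using h
  have := hv.fintype_card_le_finrank
  simp [hcard] at this

lemma numUnconfounded_le_card_edgeFinset {p q : ℕ} (d : Arrangement 2 p q n)
    (G : SimpleGraph (Fin n)) [DecidableRel G.Adj]
    (h : ∀ l m, l < m → InteractionUnconfounded d l m → G.Adj l m) :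
    numUnconfounded d ≤ G.edgeFinset.card := by
  unfold numUnconfounded
  rw [← Set.ncard_coe_finset]
  refine Set.ncard_le_ncard_of_injOn (fun e => s(e.1, e.2)) ?_ ?_ (Set.toFinite _)
  · rintro ⟨l, m⟩ ⟨h1, h2⟩
    simpa using h l m h1 h2
  · rintro ⟨l, m⟩ ⟨h1, -⟩ ⟨j, k⟩ ⟨h3, -⟩ h
    rcases Sym2.eq_iff.mp h with ⟨h, h'⟩ | ⟨h, h'⟩
    · exact Prod.ext h h'
    · dsimp only at h h' h1 h3
      subst h h'
      exact absurd h1 (not_lt_of_gt h3)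

/-- The bound `φ` on the number of unconfounded two-factor interactions. -/
lemma numUnconfounded_le_phi {p q : ℕ} (hp : 0 < p) (hpq : p ≤ q) (d : Arrangement 2 p q n)
    (hd : ∀ l, MainUnconfounded d l) : (numUnconfounded d : ℚ) ≤ phi 2 p q n := by
  classical
  have hN : 2 ≤ 2 ^ p := by
    calc 2 = 2 ^ 1 := rfl
      _ ≤ 2 ^ p := Nat.pow_le_pow_right (by norm_num) hp
  -- One array column suffices; its `2 ^ p` cells are the ambient dimension, and 0 is an arbitrary
  -- choice.
  let G := orthGraph fun x l => d (x, 0) l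
  have hG : G.CliqueFree (2 ^ p - 1 + 1) := by
    have := orthGraph_cliqueFree (fun x l => d (x, 0) l) fun l => (hd l).sum_column_eq_zero 0
    have hc : Fintype.card (Fin p → ZMod 2) = 2 ^ p - 1 + 1 := by
      simp [ZMod.card]
      omega
    rwa [hc] at this
  have h1 := card_edgeFinset_le_of_cliqueFree (by omega) G hG
  have h2 := numUnconfounded_le_card_edgeFinset d G fun l m hlm h => h.sum_column_eq_zero hlm 0
  rw [phi_two_eq hpq]
  exact le_trans (by exact_mod_cast h2) h1

end UpperBound

/-! ### Characters of the group of cells. -/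

section Characters

variable {p q n : ℕ}

/-- Translation by a unit vector at a nonzero coordinate of `a` flips every summand, so the sum is
its own negative. -/
lemma sum_sgn_dotProduct {ι : Type*} [Fintype ι] [DecidableEq ι] {a : ι → ZMod 2} (ha : a ≠ 0) :
    ∑ x : ι → ZMod 2, sgn (x ⬝ᵥ a) = 0 := by
  obtain ⟨i, hi⟩ := Function.ne_iff.mp ha
  have hi : a i = 1 := (zmod_two_cases _).resolve_left hi
  have h := Equiv.sum_comp (Equiv.addRight (Pi.single i (1 : ZMod 2)))
    fun x : ι → ZMod 2 => sgn (x ⬝ᵥ a)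
  simp only [Equiv.coe_addRight, add_dotProduct, single_dotProduct, hi, sgn_add,
    sgn_one, mul_neg, mul_one, Finset.sum_neg_distrib] at h
  linarith

/-- The real characters of the group of cells. -/
def character (a : Fin p → ZMod 2) (b : Fin q → ZMod 2) (c : Cell 2 p q) : ℝ :=
  sgn (c.1 ⬝ᵥ a + c.2 ⬝ᵥ b)

lemma character_mul (a a' : Fin p → ZMod 2) (b b' : Fin q → ZMod 2) (c : Cell 2 p q) :
    character a b c * character a' b' c = character (a + a') (b + b') c := by
  unfold character
  rw [← sgn_add, dotProduct_add, dotProduct_add]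
  congr 1
  ring

/-- `f` is constant along an array row, where only the factor with exponent `b` varies; so `b` alone
decides orthogonality to row effects. -/
lemma sum_character_mul_row (a : Fin p → ZMod 2) {b : Fin q → ZMod 2} (hb : b ≠ 0)
    (f : (Fin p → ZMod 2) → ℝ) : ∑ c, character a b c * f c.1 = 0 := by
  rw [Fintype.sum_prod_type]
  refine Finset.sum_eq_zero fun x _ => ?_
  simp only [character, sgn_add, mul_comm _ (f x)]
  rw [← Finset.mul_sum, ← Finset.mul_sum, sum_sgn_dotProduct hb]
  simp

lemma sum_character_mul_col {a : Fin p → ZMod 2} (ha : a ≠ 0) (b : Fin q → ZMod 2)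
    (f : (Fin q → ZMod 2) → ℝ) : ∑ c, character a b c * f c.2 = 0 := by
  rw [Fintype.sum_prod_type_right]
  refine Finset.sum_eq_zero fun y _ => ?_
  simp only [character, sgn_add, mul_assoc]
  rw [← Finset.sum_mul, sum_sgn_dotProduct ha, zero_mul]

lemma sum_character {a : Fin p → ZMod 2} {b : Fin q → ZMod 2} (h : a ≠ 0 ∨ b ≠ 0) :
    ∑ c, character a b c = 0 := by
  rcases h with h | h
  · simpa using sum_character_mul_col h b 1
  · simpa using sum_character_mul_row a h 1

end Characters

/-! ### Designs generated by a matrix. -/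

section LinearDesign

open Matrix

variable {p q n : ℕ} (G : Matrix (Fin p ⊕ Fin q) (Fin n) (ZMod 2))

lemma mainContrast_generatedBy (l : Fin n) :
    mainContrast (generatedBy G) l = character (G.toRows₁.col l) (G.toRows₂.col l) := rfl

lemma interContrast_generatedBy (l m : Fin n) :
    interContrast (generatedBy G) l m = character (G.toRows₁.col l + G.toRows₁.col m)
      (G.toRows₂.col l + G.toRows₂.col m) := by
  ext c
  rw [← character_mul, ← mainContrast_generatedBy, ← mainContrast_generatedBy, interContrast,
    sgn_add]
  rfl

lemma generatedBy_eq_vecMul (c : Cell 2 p q) :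
    generatedBy G c = Sum.elim c.1 c.2 ᵥ* G := by
  conv_rhs => rw [← G.fromRows_toRows, sumElim_vecMul_fromRows]
  rfl

/-- The row space is a hyperplane, hence the annihilator of any nonzero `w` with `G *ᵥ w = 0`. -/
lemma isFractionalFactorial_one (hG : LinearIndependent (ZMod 2) G.row) (hn : n = p + q + 1) :
    IsFractionalFactorial 1 (generatedBy G) := by
  have hinj : Function.Injective G.vecMul := Matrix.vecMul_injective_iff.mpr hG
  refine ⟨?_, ?_⟩
  · intro c c' h
    rw [generatedBy_eq_vecMul, generatedBy_eq_vecMul] at h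
    have h := hinj h
    exact Prod.ext (funext fun i => congr_fun h (Sum.inl i))
      (funext fun i => congr_fun h (Sum.inr i))
  have hker : LinearMap.ker G.mulVecLin ≠ ⊥ := by
    apply LinearMap.ker_ne_bot_of_finrank_lt
    simp [hn]
  obtain ⟨w, hw, hw0⟩ := Submodule.exists_mem_ne_zero_of_ne_bot hker
  have hw : G *ᵥ w = 0 := hw
  refine ⟨fun _ => w, LinearIndependent.of_subsingleton (i := 0) hw0, ?_⟩
  let φ : (Fin n → ZMod 2) →ₗ[ZMod 2] ZMod 2 := dotProductBilin (ZMod 2) (ZMod 2) w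
  have hφ : ∀ x, φ x = w ⬝ᵥ x := fun x => rfl
  have hle : LinearMap.range G.vecMulLinear ≤ LinearMap.ker φ := by
    rintro _ ⟨z, rfl⟩
    rw [LinearMap.mem_ker, hφ, dotProduct_comm, vecMulLinear_apply, ← dotProduct_mulVec, hw,
      dotProduct_zero]
  have hφ0 : φ ≠ 0 := by
    intro h
    apply hw0
    ext i
    have := hφ (Pi.single i 1)
    rw [h] at this
    simpa using this.symm
  have heq : LinearMap.range G.vecMulLinear = LinearMap.ker φ := by
    apply Submodule.eq_of_le_of_finrank_eq hle
    have h1 : Module.finrank (ZMod 2) (LinearMap.range G.vecMulLinear) = p + q := by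
      rw [LinearMap.finrank_range_of_inj hinj]
      simp
    have h2 := φ.finrank_range_add_finrank_ker
    rw [LinearMap.range_eq_top.mpr (LinearMap.surjective hφ0)] at h2
    simp [hn] at h2
    omega
  ext x
  constructor
  · rintro ⟨c, rfl⟩ -
    rw [generatedBy_eq_vecMul]
    exact hle ⟨_, rfl⟩
  · intro h
    have hx : x ∈ LinearMap.ker φ := h 0
    rw [← heq] at hx
    obtain ⟨z, rfl⟩ := hx
    refine ⟨(z ∘ Sum.inl, z ∘ Sum.inr), ?_⟩
    rw [generatedBy_eq_vecMul, Sum.elim_comp_inl_inr]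
    rfl

variable {G}

lemma toRows_ne_zero {u : Fin n → ZMod 2} (h : G *ᵥ u ≠ 0) :
    G.toRows₁ *ᵥ u ≠ 0 ∨ G.toRows₂ *ᵥ u ≠ 0 := by
  by_contra! h'
  apply h
  rw [← G.fromRows_toRows, fromRows_mulVec, h'.1, h'.2]
  ext i
  cases i <;> rfl

/-- Any four columns of `G` are linearly independent. -/
def FourIndependent (G : Matrix (Fin p ⊕ Fin q) (Fin n) (ZMod 2)) : Prop :=
  ∀ u : Fin n → ZMod 2, (∃ S : Finset (Fin n), S.card ≤ 4 ∧ ∀ i ∉ S, u i = 0) → G *ᵥ u = 0 → u = 0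

lemma FourIndependent.sum_ne_zero (hG : FourIndependent G) {u : Fin n → ZMod 2}
    (S : Finset (Fin n)) (hS : S.card ≤ 4) (hu : ∀ i ∉ S, u i = 0) (i : Fin n) (hi : u i ≠ 0) :
    G.toRows₁ *ᵥ u ≠ 0 ∨ G.toRows₂ *ᵥ u ≠ 0 :=
  toRows_ne_zero fun h => hi (congr_fun (hG u ⟨S, hS, hu⟩ h) i)

/-- Products of contrasts are characters of sums of generator columns, here at most three, which
four-independence keeps nonzero. Rows and columns of the array need the two separate conditions. -/
lemma FourIndependent.mainUnconfounded (hG : FourIndependent G) (l : Fin n)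
    (hc : G.toRows₁.col l ≠ 0) (hr : G.toRows₂.col l ≠ 0) :
    MainUnconfounded (generatedBy G) l := by
  apply mainUnconfounded_of_orthogonal
  · rw [mainContrast_generatedBy]
    exact sum_character_mul_row _ hr
  · rw [mainContrast_generatedBy]
    exact sum_character_mul_col hc _
  · intro j hj
    simp only [mainContrast_generatedBy, character_mul]
    apply sum_character
    have := hG.sum_ne_zero (u := Pi.single l 1 + Pi.single j 1) {l, j}
      (Finset.card_le_two.trans (by norm_num)) (by intro i hi; simp_all) l
      (by simp [hj.symm])
    simpa only [mulVec_add, mulVec_single_one] using this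
  · intro j k hjk
    simp only [mainContrast_generatedBy, interContrast_generatedBy, character_mul]
    apply sum_character
    have := hG.sum_ne_zero (u := Pi.single l 1 + (Pi.single j 1 + Pi.single k 1)) {l, j, k}
      (Finset.card_le_three.trans (by norm_num)) (by intro i hi; simp_all)
      -- A coordinate that survives cancellation: if `l = j` these two cancel and `k` remains;
      -- otherwise `j` occurs once.
      (if l = j then k else j) (by
        have := hjk.ne
        have := hjk.ne'
        split
        · simp_all
        · simp_all [eq_comm])
    simpa only [mulVec_add, mulVec_single_one] using this

lemma FourIndependent.interactionUnconfounded (hG : FourIndependent G) {l m : Fin n} (hlm : l < m)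
    (hc : G.toRows₁.col l ≠ G.toRows₁.col m) (hr : G.toRows₂.col l ≠ G.toRows₂.col m) :
    InteractionUnconfounded (generatedBy G) l m := by
  have hadd : ∀ {r : ℕ} {a b : Fin r → ZMod 2}, a ≠ b → a + b ≠ 0 := by
    intro r a b hab h
    apply hab
    ext i
    have := congr_fun h i
    exact CharTwo.add_eq_zero.mp this
  apply interactionUnconfounded_of_orthogonal hlm
  · rw [interContrast_generatedBy]
    exact sum_character_mul_row _ (hadd hr)
  · rw [interContrast_generatedBy]
    exact sum_character_mul_col (hadd hc) _
  · intro j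
    simp only [mainContrast_generatedBy, interContrast_generatedBy, character_mul]
    apply sum_character
    have := hG.sum_ne_zero (u := Pi.single l 1 + Pi.single m 1 + Pi.single j 1) {l, m, j}
      (Finset.card_le_three.trans (by norm_num)) (by intro i hi; simp_all)
      (if j = l then m else l) (by
        have := hlm.ne
        have := hlm.ne'
        split
        · simp_all
        · simp_all [eq_comm])
    simpa only [mulVec_add, mulVec_single_one] using this
  · intro j k hjk hne
    simp only [interContrast_generatedBy, character_mul]
    apply sum_character
    have := hG.sum_ne_zero
      (u := Pi.single l 1 + Pi.single m 1 + (Pi.single j 1 + Pi.single k 1)) {l, m, j, k}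
      Finset.card_le_four (by intro i hi; simp_all)
      -- If `l` is cancelled by `j` or `k`, then `m` is not, because the ordered pairs differ.
      (if l = j ∨ l = k then m else l) (by
        have := hlm.ne
        have := hlm.ne'
        split
        · have h1 : m ≠ j := by
            rintro rfl
            rename_i h
            rcases h with h | h
            · exact hlm.ne h
            · subst h
              exact absurd hlm (not_lt_of_gt hjk)
          have h2 : m ≠ k := by
            rintro rfl
            rename_i h
            rcases h with h | h
            · subst h
              exact hne rfl
            · exact hlm.ne h
          simp_all
        · simp_all)
    simpa only [mulVec_add, mulVec_single_one] using this

end LinearDesign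

/-! ### The explicit generator matrix. -/

section Generator

open Matrix

lemma sum_K {p : ℕ} (i : Fin p) : ∑ k, K p i k = ((p - i : ℕ) : ZMod 2) := by
  have : (Finset.univ.filter fun k => i ≤ k) = Finset.Ici i := by ext; simp
  simp [K, this]

lemma K_apply {p : ℕ} (i j : Fin p) : K p i j = if i ≤ j then 1 else 0 := rfl

lemma K_mul_J_apply {p : ℕ} (i j : Fin p) : (K p * J p) i j = ((p - i : ℕ) : ZMod 2) := by
  rw [mul_apply, ← sum_K]
  simp [J]

/-- `1 + K` deletes the diagonal of `K`, and `K * J` has constant rows, given by the parity of the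
row sums of `K`. -/
lemma L_apply {p : ℕ} (i j : Fin p) :
    L p i j = (if i < j then 1 else 0) + ((p - i : ℕ) : ZMod 2) := by
  have h : (1 + 1 : ZMod 2) = 0 := by decide
  rw [L, mul_add, mul_one, Matrix.add_apply, Matrix.add_apply, K_mul_J_apply, K_apply, one_apply,
    ← add_assoc]
  rcases lt_trichotomy i j with hij | rfl | hij
  · simp [hij.ne, hij.le, hij]
  · simp [h]
  · simp [hij.ne', hij.not_ge, hij.not_gt]

lemma K_mul_ones_add_ones_apply {p : ℕ} (i : Fin p) (j : Fin 1) :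
    (K p * ones p + ones p) i j = ((p - i : ℕ) : ZMod 2) + 1 := by
  rw [Matrix.add_apply, mul_apply, ← sum_K]
  simp [ones]

variable {p q n : ℕ}

lemma lowerPart_col_ne_zero (hp : 3 ≤ p) (c : ColIdx p q) : (lowerPart p q).col c ≠ 0 := by
  intro h
  rcases c with ((j | j) | j) | j
  · have := congr_fun h (Sum.inl j)
    simp [lowerPart, K_apply] at this
  · have := congr_fun h (Sum.inl ⟨p - 1, by omega⟩)
    have h1 : p - (p - 1) = 1 := by omega
    have h2 : ¬ (⟨p - 1, by omega⟩ : Fin p) < j := by simp [Fin.lt_def]; omega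
    simp [lowerPart, L_apply, h1, h2] at this
  · have := congr_fun h (Sum.inl ⟨p - 2, by omega⟩)
    have h1 : p - (p - 2) = 2 := by omega
    simp only [lowerPart, col_apply, fromBlocks_apply₁₁, fromCols_apply_inr,
      K_mul_ones_add_ones_apply, h1, Pi.zero_apply] at this
    revert this; decide
  · have := congr_fun h (Sum.inr j)
    simp [lowerPart] at this

/-- Triangularity separates columns within `K` and within `L`. The parities 1, 0, 1 of `p - i` in
the last three rows separate `K`, `L` and the extra column; this uses `3 ≤ p`. The identity block
separates the rest. -/
lemma lowerPart_col_injective (hp : 3 ≤ p) : Function.Injective (lowerPart p q).col := by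
  have hz : ((1 : ℕ) : ZMod 2) = 1 ∧ ((2 : ℕ) : ZMod 2) = 0 ∧ ((3 : ℕ) : ZMod 2) = 1 := by decide
  have h11 : (1 + 1 : ZMod 2) = 0 := by decide
  have e1 : p - (p - 1) = 1 := by omega
  have e2 : p - (p - 2) = 2 := by omega
  have e3 : p - (p - 3) = 3 := by omega
  have hKL : ∀ j m : Fin p, ∃ i, K p i j ≠ L p i m := by
    intro j m
    by_contra! h
    have h1 := h ⟨p - 1, by omega⟩
    have h2 := h ⟨p - 2, by omega⟩
    have h3 := h ⟨p - 3, by omega⟩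
    simp only [K_apply, L_apply, e1, e2, e3, hz, Fin.lt_def, Fin.le_def] at h1 h2 h3
    -- The last row of `L` is all ones, forcing `j` to be the last, all-ones column of `K`; row `p -
    -- 2` then makes `m` last too, and row `p - 3` gives `1 = 1 + 1`.
    rw [if_neg (by omega : ¬ p - 1 < m.val)] at h1
    have hj : p - 1 ≤ j.val := by
      by_contra hj
      simp [hj] at h1
    rw [if_pos (by omega)] at h2 h3
    have hm : p - 2 < m.val := by
      by_contra hm
      simp [hm] at h2
    rw [if_pos (by omega), h11] at h3
    exact one_ne_zero h3
  have hKC : ∀ (j : Fin p) (m : Fin 1), ∃ i, K p i j ≠ (K p * ones p + ones p) i m := by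
    intro j m
    by_contra! h
    have h2 := h ⟨p - 2, by omega⟩
    have h3 := h ⟨p - 3, by omega⟩
    simp only [K_apply, K_mul_ones_add_ones_apply, e2, e3, hz, Fin.le_def, zero_add, h11]
      at h2 h3
    have hj : p - 2 ≤ j.val := by
      by_contra hj
      simp [hj] at h2
    rw [if_pos (by omega)] at h3
    exact one_ne_zero h3
  have hLC : ∀ (j : Fin p) (m : Fin 1), ∃ i, L p i j ≠ (K p * ones p + ones p) i m := by
    intro j m
    by_contra! h
    have h1 := h ⟨p - 1, by omega⟩
    simp only [L_apply, K_mul_ones_add_ones_apply, Fin.lt_def, e1, hz, h11] at h1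
    rw [if_neg (by omega : ¬ p - 1 < j.val), zero_add] at h1
    exact one_ne_zero h1
  have hL : ∀ j m : Fin p, j < m → ∃ i, L p i j ≠ L p i m := by
    intro j m hjm
    refine ⟨j, ?_⟩
    simp [L_apply, hjm]
  intro c c' h
  have hl : ∀ i, lowerPart p q (Sum.inl i) c = lowerPart p q (Sum.inl i) c' :=
    fun i => congr_fun h (Sum.inl i)
  have hr : ∀ i, lowerPart p q (Sum.inr i) c = lowerPart p q (Sum.inr i) c' :=
    fun i => congr_fun h (Sum.inr i)
  rcases c with ((j | j) | j) | j <;> rcases c' with ((m | m) | m) | m <;>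
    simp only [lowerPart, fromBlocks_apply₁₁, fromBlocks_apply₁₂, fromBlocks_apply₂₁,
      fromBlocks_apply₂₂, fromCols_apply_inl, fromCols_apply_inr, Matrix.zero_apply] at hl hr
  · have h1 := hl j
    have h2 := hl m
    simp only [K_apply, le_refl, if_true] at h1 h2
    have h1 : j ≤ m := by by_contra h'; simp [h'] at h1
    have h2 : m ≤ j := by by_contra h'; simp [h'] at h2
    rw [le_antisymm h1 h2]
  · obtain ⟨i, hi⟩ := hKL j m
    exact absurd (hl i) hi
  · obtain ⟨i, hi⟩ := hKC j m
    exact absurd (hl i) hi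
  · simpa [Matrix.one_apply] using hr m
  · obtain ⟨i, hi⟩ := hKL m j
    exact absurd (hl i).symm hi
  · rcases lt_trichotomy j m with hjm | rfl | hjm
    · obtain ⟨i, hi⟩ := hL j m hjm
      exact absurd (hl i) hi
    · rfl
    · obtain ⟨i, hi⟩ := hL m j hjm
      exact absurd (hl i).symm hi
  · obtain ⟨i, hi⟩ := hLC j m
    exact absurd (hl i) hi
  · simpa [Matrix.one_apply] using hr m
  · obtain ⟨i, hi⟩ := hKC m j
    exact absurd (hl i).symm hi
  · obtain ⟨i, hi⟩ := hLC m j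
    exact absurd (hl i).symm hi
  · rw [Subsingleton.elim j m]
  · simpa [Matrix.one_apply] using hr m
  · simpa [Matrix.one_apply] using hr j
  · simpa [Matrix.one_apply] using hr j
  · simpa [Matrix.one_apply] using hr j
  · have := hr m
    by_contra hjm
    have hjm : m ≠ j := fun h' => hjm (by rw [h'])
    simp [hjm] at this

variable (X : Matrix (Fin p) (Fin (q - p)) (ZMod 2))

lemma upperPart_col_ne_zero (hp : 3 ≤ p) (hX : ∀ j, X.col j ≠ 0) (c : ColIdx p q) :
    (upperPart p q X).col c ≠ 0 := by
  intro h
  have h' : ∀ i, upperPart p q X i c = 0 := congr_fun h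
  rcases c with ((j | j) | j) | j
  · simpa [upperPart] using h' j
  · have : Nontrivial (Fin p) := Fin.nontrivial_iff_two_le.mpr (by omega)
    obtain ⟨i, hi⟩ := exists_ne j
    simpa [upperPart, J, Matrix.one_apply, hi] using h' i
  · simpa [upperPart, ones] using h' ⟨0, by omega⟩
  · exact hX j (funext h')

/-- Distinctness lets the `2p + 1` prescribed columns start a list of all points, and supplies an
unconfounded interaction. -/
lemma upperPart_col_inl_injective (hp : 3 ≤ p) :
    Function.Injective fun b : (Fin p ⊕ Fin p) ⊕ Fin 1 => (upperPart p q X).col (Sum.inl b) := by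
  have hex : ∀ j m : Fin p, ∃ i, i ≠ j ∧ i ≠ m := by
    intro j m
    obtain ⟨i, hi⟩ := Finset.exists_mem_notMem_of_card_lt_card
      (s := {j, m}) (t := Finset.univ) (Finset.card_le_two.trans_lt (by simp; omega))
    exact ⟨i, by simpa using hi⟩
  have h11 : (1 + 1 : ZMod 2) = 0 := by decide
  intro c c' h
  have h' : ∀ i, upperPart p q X i (Sum.inl c) = upperPart p q X i (Sum.inl c') := congr_fun h
  rcases c with (j | j) | j <;> rcases c' with (m | m) | m <;>
    simp only [upperPart, fromCols_apply_inl, fromCols_apply_inr, Matrix.add_apply, J, ones,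
      Matrix.of_apply, Matrix.one_apply] at h'
  · have := h' j
    by_contra hjm
    have hjm : j ≠ m := fun e => hjm (by rw [e])
    simp [hjm] at this
  · obtain ⟨i, h1, h2⟩ := hex j m
    simpa [h1, h2] using h' i
  · obtain ⟨i, h1, -⟩ := hex j j
    simpa [h1] using h' i
  · obtain ⟨i, h1, h2⟩ := hex j m
    simpa [h1, h2] using h' i
  · have := h' j
    by_contra hjm
    have hjm : j ≠ m := fun e => hjm (by rw [e])
    simp [hjm, h11] at this
  · simpa [h11] using h' j
  · obtain ⟨i, h1, -⟩ := hex m m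
    simpa [h1] using h' i
  · simpa [h11] using h' m
  · rw [Subsingleton.elim j m]

/-- For a vanishing row combination `(x, y, z)`, the first block gives `x + yK = 0`; the second is
`(x + yK)(I + J) + y`, so `y = 0`, then `x = 0` and `z = 0`. -/
lemma generator_linearIndependent (hpq : p ≤ q) (hn : n = p + q + 1) :
    LinearIndependent (ZMod 2) (generator hpq hn X).row := by
  have key : ∀ (x y : Fin p → ZMod 2) (z : Fin (q - p) → ZMod 2),
      Sum.elim x (Sum.elim y z) ᵥ* (upperPart p q X).fromRows (lowerPart p q) = 0 →
        x = 0 ∧ y = 0 ∧ z = 0 := by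
    intro x y z h
    rw [sumElim_vecMul_fromRows, upperPart, lowerPart, vecMul_fromBlocks, vecMul_fromCols,
      vecMul_fromCols, vecMul_fromCols] at h
    have h1 : x ᵥ* 1 + (y ᵥ* K p) = 0 := by
      ext i
      have := congr_fun h (Sum.inl (Sum.inl (Sum.inl i)))
      simpa [vecMul_fromCols] using this
    have h2 : x ᵥ* (1 + J p) + (y ᵥ* L p) = 0 := by
      ext i
      have := congr_fun h (Sum.inl (Sum.inl (Sum.inr i)))
      simpa [vecMul_fromCols] using this
    have h3 : x ᵥ* X + z = 0 := by
      ext i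
      have := congr_fun h (Sum.inr i)
      simpa [vecMul_fromCols] using this
    rw [vecMul_one] at h1
    rw [L, vecMul_add 1 (K p * (1 + J p)) y, vecMul_one, ← vecMul_vecMul, add_left_comm, ← add_vecMul, h1,
      zero_vecMul, add_zero] at h2
    subst h2
    simp only [zero_vecMul, add_zero] at h1
    subst h1
    simpa using h3
  rw [← vecMul_injective_iff]
  rw [← coe_vecMulLinear, injective_iff_map_eq_zero]
  intro v hv
  rw [vecMulLinear_apply, generator, reindex_apply, submatrix_vecMul_equiv] at hv
  set v' := v ∘ ((Equiv.refl (Fin p)).sumCongr (rowEquiv hpq)).symm.symm with hv'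
  have hv0 : v' ᵥ* (upperPart p q X).fromRows (lowerPart p q) = 0 := by
    ext c
    simpa using congr_fun hv (colEquiv hpq hn c)
  have hsplit : v' = Sum.elim (v' ∘ Sum.inl)
      (Sum.elim (v' ∘ Sum.inr ∘ Sum.inl) (v' ∘ Sum.inr ∘ Sum.inr)) := by
    ext i
    rcases i with i | i | i <;> rfl
  rw [hsplit] at hv0
  obtain ⟨h1, h2, h3⟩ := key _ _ _ hv0
  have : v' = 0 := by
    rw [hsplit, h1, h2, h3]
    ext i
    rcases i with i | i | i <;> rfl
  ext i
  simpa [hv'] using congr_fun this (((Equiv.refl (Fin p)).sumCongr (rowEquiv hpq)).symm i)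

/-- Comparing `K` times the upper equations with the lower ones makes every entry of `u₂` equal to
the scalar `u₃`; the upper equations then give `u₁` the constant value `p * u₃`. A nonzero kernel
vector thus has weight `p + 1` for even `p` and `2p + 1` for odd `p`, always above 4. -/
lemma fourIndependent_generator (hp : 3 ≤ p) (hpq : p ≤ q) (hn : n = p + q + 1) :
    FourIndependent (generator hpq hn X) := by
  rintro v ⟨S, hS, hv⟩ h
  set u : ColIdx p q → ZMod 2 := v ∘ colEquiv hpq hn with hu
  have h0 : (upperPart p q X).fromRows (lowerPart p q) *ᵥ u = 0 := by
    rw [generator, reindex_apply, submatrix_mulVec_equiv] at h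
    ext i
    simpa using congr_fun h (((Equiv.refl (Fin p)).sumCongr (rowEquiv hpq)) i)
  obtain ⟨u₁, u₂, u₃, u₄, hsplit⟩ : ∃ (u₁ u₂ : Fin p → ZMod 2) (u₃ : Fin 1 → ZMod 2)
      (u₄ : Fin (q - p) → ZMod 2), u = Sum.elim (Sum.elim (Sum.elim u₁ u₂) u₃) u₄ :=
    ⟨fun i => u (Sum.inl (Sum.inl (Sum.inl i))), fun i => u (Sum.inl (Sum.inl (Sum.inr i))),
      fun i => u (Sum.inl (Sum.inr i)), fun i => u (Sum.inr i), by
        ext i; rcases i with ((i | i) | i) | i <;> rfl⟩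
  rw [hsplit, fromRows_mulVec] at h0
  have hup : u₁ + (1 + J p) *ᵥ u₂ + ones p *ᵥ u₃ + X *ᵥ u₄ = 0 := by
    ext i
    simpa [upperPart, fromCols_mulVec_sumElim] using congr_fun h0 (Sum.inl i)
  have hlo : K p *ᵥ u₁ + L p *ᵥ u₂ + (K p * ones p + ones p) *ᵥ u₃ = 0 := by
    ext i
    simpa [lowerPart, fromBlocks_mulVec, fromCols_mulVec_sumElim] using
      congr_fun h0 (Sum.inr (Sum.inl i))
  have h4 : u₄ = 0 := by
    ext i
    simpa [lowerPart, fromBlocks_mulVec] using congr_fun h0 (Sum.inr (Sum.inr i))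
  subst h4
  rw [mulVec_zero, add_zero] at hup
  have h2 : u₂ + ones p *ᵥ u₃ = 0 := by
    have hK : K p *ᵥ (u₁ + (1 + J p) *ᵥ u₂ + ones p *ᵥ u₃) = 0 := by rw [hup, mulVec_zero]
    rw [L, add_mulVec, add_mulVec, one_mulVec, ← mulVec_mulVec, ← mulVec_mulVec] at hlo
    rw [mulVec_add, mulVec_add] at hK
    rw [← hlo] at hK
    rw [← sub_eq_zero] at hK
    have : u₂ + ones p *ᵥ u₃ = -(K p *ᵥ u₁ + K p *ᵥ (1 + J p) *ᵥ u₂ + K p *ᵥ ones p *ᵥ u₃ -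
      (K p *ᵥ u₁ + (u₂ + K p *ᵥ (1 + J p) *ᵥ u₂) + (K p *ᵥ ones p *ᵥ u₃ + ones p *ᵥ u₃))) := by
      abel
    rw [this, hK, neg_zero]
  have h2' : ∀ i, u₂ i = u₃ 0 := by
    intro i
    have := congr_fun h2 i
    simp only [Pi.add_apply, mulVec, dotProduct, ones, Matrix.of_apply, Finset.univ_unique,
      Finset.sum_singleton, one_mul, Pi.zero_apply] at this
    exact CharTwo.add_eq_zero.mp this
  have h1' : ∀ i, u₁ i = p * u₃ 0 := by
    intro i
    have := congr_fun hup i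
    simp only [add_mulVec, one_mulVec, Pi.add_apply, mulVec, dotProduct, ones, J, Matrix.of_apply,
      Finset.univ_unique, Finset.sum_singleton, one_mul, Pi.zero_apply, h2', Finset.sum_const,
      Finset.card_univ, Fintype.card_fin, nsmul_eq_mul] at this
    have hd : (default : Fin 1) = 0 := rfl
    rw [hd] at this
    have h22 := CharTwo.add_self_eq_zero (u₃ 0)
    have : u₁ i + p * u₃ 0 = 0 := by linear_combination this - h22
    exact CharTwo.add_eq_zero.mp this
  have hu0 : u = 0 := by
    rcases zmod_two_cases (u₃ 0) with h3 | h3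
    · rw [hsplit]
      ext i
      rcases i with ((i | i) | i) | i
      · simp [h1', h3]
      · simp [h2', h3]
      · simp [Subsingleton.elim i 0, h3]
      · simp
    · exfalso
      have hmem : ∀ c, u c = 1 → colEquiv hpq hn c ∈ S := by
        intro c hc
        by_contra h'
        have := hv _ h'
        rw [hu, Function.comp_apply, this] at hc
        exact zero_ne_one hc
      have h21 : ∀ i, u (Sum.inl (Sum.inl (Sum.inr i))) = 1 := by
        intro i; rw [hsplit]; simp [h2', h3]
      have h31 : ∀ i, u (Sum.inl (Sum.inr i)) = 1 := by
        intro i; rw [hsplit]; simp [Subsingleton.elim i 0, h3]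
      have hle : p + 1 ≤ S.card := by
        have := Finset.card_le_card_of_injOn (s := (Finset.univ : Finset (Fin p ⊕ Fin 1)))
          (t := S) (fun i => colEquiv hpq hn (Sum.inl (i.elim (Sum.inl ∘ Sum.inr) Sum.inr)))
          (by rintro (i | i) -
              · exact hmem _ (h21 i)
              · exact hmem _ (h31 i))
          (by rintro (i | i) - (j | j) - hij <;> simp_all)
        simpa using this
      -- Weight at least `p + 1` settles `p ≥ 4`; for `p = 3` odd parity makes `u₁` all ones as
      -- well, giving six further-counted columns.
      obtain rfl : p = 3 := by omega
      have h11 : ∀ i, u (Sum.inl (Sum.inl (Sum.inl i))) = 1 := by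
        intro i; rw [hsplit]; simp only [Sum.elim_inl, h1', h3]; decide
      have := Finset.card_le_card_of_injOn (s := (Finset.univ : Finset (Fin 3 ⊕ Fin 3)))
          (t := S) (fun i => colEquiv hpq hn (Sum.inl (Sum.inl i)))
          (by rintro (i | i) -
              · exact hmem _ (h11 i)
              · exact hmem _ (h21 i))
          (by intro i _ j _ hij; simpa using hij)
      simp at this
      omega
  ext i
  simpa [hu] using congr_fun hu0 ((colEquiv hpq hn).symm i)

lemma generator_toRows₁_col (hpq : p ≤ q) (hn : n = p + q + 1) (c : ColIdx p q) :
    (generator hpq hn X).toRows₁.col (colEquiv hpq hn c) = (upperPart p q X).col c := by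
  ext i
  simp [generator, toRows₁]

lemma generator_toRows₂_col (hpq : p ≤ q) (hn : n = p + q + 1) (c : ColIdx p q) :
    (generator hpq hn X).toRows₂.col (colEquiv hpq hn c) =
      (lowerPart p q).col c ∘ (rowEquiv hpq).symm := by
  ext i
  simp [generator, toRows₂]

lemma mainUnconfounded_generator (hp : 3 ≤ p) (hpq : p ≤ q) (hn : n = p + q + 1)
    (hX : ∀ j, X.col j ≠ 0) (l : Fin n) :
    MainUnconfounded (generatedBy (generator hpq hn X)) l := by
  obtain ⟨c, rfl⟩ := (colEquiv hpq hn).surjective l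
  apply (fourIndependent_generator X hp hpq hn).mainUnconfounded
  · rw [generator_toRows₁_col]
    exact upperPart_col_ne_zero X hp hX c
  · rw [generator_toRows₂_col]
    intro h
    apply lowerPart_col_ne_zero hp c
    ext i
    simpa using congr_fun h (rowEquiv hpq i)

/-- Lower columns are pairwise distinct, so row effects never obstruct an interaction. -/
lemma interactionUnconfounded_generator (hp : 3 ≤ p) (hpq : p ≤ q) (hn : n = p + q + 1)
    {l m : Fin n} (hlm : l < m)
    (h : (generator hpq hn X).toRows₁.col l ≠ (generator hpq hn X).toRows₁.col m) :
    InteractionUnconfounded (generatedBy (generator hpq hn X)) l m := by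
  apply (fourIndependent_generator X hp hpq hn).interactionUnconfounded hlm h
  obtain ⟨c, rfl⟩ := (colEquiv hpq hn).surjective l
  obtain ⟨c', rfl⟩ := (colEquiv hpq hn).surjective m
  rw [generator_toRows₂_col, generator_toRows₂_col]
  intro h'
  have : c = c' := by
    apply lowerPart_col_injective hp
    ext i
    simpa using congr_fun h' (rowEquiv hpq i)
  rw [this] at hlm
  exact lt_irrefl _ hlm

end Generator

/-! ### Counting pairs, and existence of admissible blocks. -/

section Counting

open Matrix

/-- The number of pairs of indices with different values, in terms of the sizes of the fibers. -/
lemma two_mul_card_lt_ne {n : ℕ} {V : Type*} [Fintype V] [DecidableEq V] (a : Fin n → V) :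
    (2 : ℚ) * (Finset.univ.filter fun e : Fin n × Fin n => e.1 < e.2 ∧ a e.1 ≠ a e.2).card =
      (n : ℚ) ^ 2 - ∑ v, ((Finset.univ.filter fun l => a l = v).card : ℚ) ^ 2 := by
  have h1 : (Finset.univ.filter fun e : Fin n × Fin n => e.1 < e.2 ∧ a e.1 ≠ a e.2).card =
      (Finset.univ.filter fun e : Fin n × Fin n => e.2 < e.1 ∧ a e.1 ≠ a e.2).card := by
    refine Finset.card_bij (fun e _ => e.swap) ?_ ?_ ?_
    · rintro ⟨l, m⟩ h
      simpa [eq_comm] using h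
    · intro e _ e' _ h
      exact Prod.swap_injective h
    · rintro ⟨l, m⟩ h
      exact ⟨(m, l), by simpa [eq_comm] using h, rfl⟩
  have h2 : (Finset.univ.filter fun e : Fin n × Fin n => a e.1 = a e.2).card =
      ∑ v, (Finset.univ.filter fun l => a l = v).card ^ 2 := by
    rw [Finset.card_eq_sum_card_fiberwise (f := fun e => a e.1) (t := Finset.univ)
      (fun _ _ => Finset.mem_coe.mpr (Finset.mem_univ _))]
    refine Finset.sum_congr rfl fun v _ => ?_
    rw [sq, ← Finset.card_product]
    congr 1
    ext ⟨l, m⟩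
    simp only [Finset.mem_filter, Finset.mem_univ, true_and, Finset.mem_product]
    constructor
    · rintro ⟨h, rfl⟩
      exact ⟨rfl, h.symm⟩
    · rintro ⟨rfl, h⟩
      exact ⟨h.symm, rfl⟩
  have h3 : n ^ 2 = (Finset.univ.filter fun e : Fin n × Fin n => e.1 < e.2 ∧ a e.1 ≠ a e.2).card +
      (Finset.univ.filter fun e : Fin n × Fin n => e.2 < e.1 ∧ a e.1 ≠ a e.2).card +
      (Finset.univ.filter fun e : Fin n × Fin n => a e.1 = a e.2).card := by
    rw [← Finset.card_union_of_disjoint, ← Finset.card_union_of_disjoint]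
    · have : (Finset.univ : Finset (Fin n × Fin n)).card = n ^ 2 := by simp [sq]
      rw [← this]
      congr 1
      ext ⟨l, m⟩
      simp only [Finset.mem_univ, Finset.mem_union, Finset.mem_filter, true_and, true_iff]
      rcases lt_trichotomy l m with h | rfl | h
      · tauto
      · tauto
      · tauto
    · rw [Finset.disjoint_left]
      intro e
      simp only [Finset.mem_union, Finset.mem_filter, Finset.mem_univ, true_and]
      tauto
    · rw [Finset.disjoint_left]
      intro e
      simp only [Finset.mem_filter, Finset.mem_univ, true_and]
      rintro ⟨h, -⟩ ⟨h', -⟩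
      exact lt_asymm h h'
  rw [← h1, h2] at h3
  have h4 := congrArg (Nat.cast (R := ℚ)) h3
  push_cast at h4
  linarith

/-- Over two elements a projective point has one nonzero representative, so point counts become
vector counts. -/
lemma span_singleton_eq_iff {V : Type*} [AddCommGroup V] [Module (ZMod 2) V] {v w : V}
    (hv : v ≠ 0) : Submodule.span (ZMod 2) {w} = Submodule.span (ZMod 2) {v} ↔ w = v := by
  constructor
  · intro h
    have hw : w ∈ Submodule.span (ZMod 2) {v} := h ▸ Submodule.mem_span_singleton_self w
    obtain ⟨t, rfl⟩ := Submodule.mem_span_singleton.mp hw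
    rcases zmod_two_cases t with rfl | rfl
    · rw [zero_smul, Submodule.span_zero_singleton, eq_comm,
        Submodule.span_singleton_eq_bot] at h
      exact absurd h hv
    · rw [one_smul]
  · rintro rfl
    rfl

lemma pointCount_mk {p : ℕ} {ι : Type} [Fintype ι] (M : Matrix (Fin p) ι (ZMod 2))
    (v : Fin p → ZMod 2) (hv : v ≠ 0) :
    pointCount M (Projectivization.mk (ZMod 2) v hv) =
      (Finset.univ.filter fun j => M.col j = v).card := by
  rw [pointCount, ← Set.ncard_coe_finset]
  congr 1
  ext j
  simp [Projectivization.submodule_mk, span_singleton_eq_iff hv]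

variable {p q n : ℕ}

lemma isAdmissible_iff (X : Matrix (Fin p) (Fin (q - p)) (ZMod 2)) :
    IsAdmissible p q n X ↔ (∀ j, X.col j ≠ 0) ∧ ∀ v : Fin p → ZMod 2, v ≠ 0 →
      (Finset.univ.filter fun c => (upperPart p q X).col c = v).card = n / (2 ^ p - 1) ∨
      (Finset.univ.filter fun c => (upperPart p q X).col c = v).card = n / (2 ^ p - 1) + 1 := by
  refine and_congr_right fun _ => ⟨fun h v hv => ?_, fun h P => ?_⟩
  · rw [← pointCount_mk _ v hv]
    exact h _
  · induction P with
    | h v hv =>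
      rw [pointCount_mk]
      exact h v hv

lemma phi_le_numUnconfounded_generator (hp : 3 ≤ p) (hpq : p ≤ q) (hn : n = p + q + 1)
    (X : Matrix (Fin p) (Fin (q - p)) (ZMod 2)) (hX : IsAdmissible p q n X) :
    phi 2 p q n ≤ numUnconfounded (generatedBy (generator hpq hn X)) := by
  classical
  rw [isAdmissible_iff] at hX
  obtain ⟨hX0, hX⟩ := hX
  set a := (generator hpq hn X).toRows₁.col with ha
  set α := n / (2 ^ p - 1) with hα
  have hk : ∀ v, (Finset.univ.filter fun l => a l = v).card =
      (Finset.univ.filter fun c => (upperPart p q X).col c = v).card := by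
    intro v
    refine (Finset.card_equiv (colEquiv hpq hn) fun c => ?_).symm
    simp [ha, generator_toRows₁_col]
  have hcard : ∑ v, ((Finset.univ.filter fun l => a l = v).card : ℚ) = n := by
    have := Finset.card_eq_sum_card_fiberwise (f := a) (s := Finset.univ) (t := Finset.univ)
      (fun _ _ => Finset.mem_coe.mpr (Finset.mem_univ _))
    rw [Finset.card_univ, Fintype.card_fin] at this
    exact_mod_cast this.symm
  have hzero : (Finset.univ.filter fun l => a l = 0).card = 0 := by
    rw [hk, Finset.card_eq_zero, Finset.filter_eq_empty_iff]
    intro c _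
    exact upperPart_col_ne_zero X hp hX0 c
  have hsq : ∑ v, ((Finset.univ.filter fun l => a l = v).card : ℚ) ^ 2 =
      (2 * (α : ℚ) + 1) * n - (2 ^ p - 1 : ℕ) * (α * (α + 1)) := by
    rw [← hcard, Finset.mul_sum, ← Finset.add_sum_erase _ _ (Finset.mem_univ 0),
      ← Finset.add_sum_erase Finset.univ
        (fun v => (2 * (α : ℚ) + 1) * ((Finset.univ.filter fun l => a l = v).card : ℚ))
        (Finset.mem_univ 0), hzero]
    have hc : (Finset.univ.erase (0 : Fin p → ZMod 2)).card = 2 ^ p - 1 := by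
      rw [Finset.card_erase_of_mem (Finset.mem_univ _), Finset.card_univ]
      simp
    rw [← hc, ← nsmul_eq_mul (Finset.card _), ← Finset.sum_const]
    simp only [Nat.cast_zero, ne_eq, OfNat.ofNat_ne_zero, not_false_eq_true, zero_pow, zero_add,
      mul_zero]
    rw [← Finset.sum_sub_distrib]
    refine Finset.sum_congr rfl fun v hv => ?_
    -- Both `α` and `α + 1` satisfy `k² = (2α + 1)k - α(α + 1)`, so the sum of squares depends only
    -- on the total `n`.
    rcases hX v (Finset.ne_of_mem_erase hv) with h | h
    · rw [hk, h]
      ring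
    · rw [hk, h]
      push_cast
      ring
  have h1 := two_mul_card_lt_ne a
  have h2 := two_mul_phi_two hpq n
  rw [hsq] at h1
  rw [← hα] at h2
  have h3 : (Finset.univ.filter fun e : Fin n × Fin n => e.1 < e.2 ∧ a e.1 ≠ a e.2).card ≤
      numUnconfounded (generatedBy (generator hpq hn X)) := by
    rw [numUnconfounded, ← Set.ncard_coe_finset]
    refine Set.ncard_le_ncard ?_ (Set.toFinite _)
    intro e he
    simp only [Finset.coe_filter, Finset.mem_univ, true_and, Set.mem_ofPred_eq] at he
    exact ⟨he.1, interactionUnconfounded_generator X hp hpq hn he.1 he.2⟩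
  have h3 : ((Finset.univ.filter fun e : Fin n × Fin n => e.1 < e.2 ∧ a e.1 ≠ a e.2).card : ℚ) ≤
      numUnconfounded (generatedBy (generator hpq hn X)) := by exact_mod_cast h3
  linarith

/-- This excludes `0 / 0` in the efficiency. -/
lemma numUnconfounded_generator_pos (hp : 3 ≤ p) (hpq : p ≤ q) (hn : n = p + q + 1)
    (X : Matrix (Fin p) (Fin (q - p)) (ZMod 2)) :
    0 < numUnconfounded (generatedBy (generator hpq hn X)) := by
  have hinj := upperPart_col_inl_injective (q := q) X hp
  have hne : (upperPart p q X).col (Sum.inl (Sum.inr 0)) ≠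
      (upperPart p q X).col (Sum.inl (Sum.inl (Sum.inl ⟨0, by omega⟩))) :=
    fun h => by simpa using hinj h
  rw [← generator_toRows₁_col X hpq hn, ← generator_toRows₁_col X hpq hn] at hne
  rw [numUnconfounded, Set.ncard_pos (Set.toFinite _)]
  rcases lt_trichotomy (colEquiv hpq hn (Sum.inl (Sum.inr 0)))
    (colEquiv hpq hn (Sum.inl (Sum.inl (Sum.inl ⟨0, by omega⟩)))) with h | h | h
  · exact ⟨(_, _), h, interactionUnconfounded_generator X hp hpq hn h hne⟩
  · exact absurd (by rw [h]) hne
  · exact ⟨(_, _), h, interactionUnconfounded_generator X hp hpq hn h hne.symm⟩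

lemma two_mul_add_one_le (hp : 3 ≤ p) : p + p + 1 ≤ 2 ^ p - 1 := by
  induction p, hp using Nat.le_induction with
  | base => norm_num
  | succ p _ ih => rw [pow_succ]; omega

/-- The columns are chosen cyclically from a list of all points that begins with the `2p + 1`
prescribed ones. -/
lemma exists_isAdmissible (hp : 3 ≤ p) (hpq : p ≤ q) (hn : n = p + q + 1) :
    ∃ X : Matrix (Fin p) (Fin (q - p)) (ZMod 2), IsAdmissible p q n X := by
  classical
  set N := 2 ^ p - 1 with hN
  have hle : p + p + 1 ≤ N := two_mul_add_one_le hp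
  have hNpos : 0 < N := by omega
  -- Taking `q = p` makes the last block empty, leaving only the prescribed columns.
  let f : (Fin p ⊕ Fin p) ⊕ Fin 1 → Fin p → ZMod 2 := fun b =>
    (upperPart p p 0).col (Sum.inl b)
  have hf0 : ∀ b, f b ≠ 0 := fun b =>
    upperPart_col_ne_zero 0 hp (fun j => by have := j.2; omega) _
  have hf : Function.Injective f := upperPart_col_inl_injective 0 hp
  let T : Finset (Fin p → ZMod 2) := Finset.univ.erase 0
  have hT : Fintype.card (((Fin p ⊕ Fin p) ⊕ Fin 1) ⊕ Fin (N - (p + p + 1))) = T.card := by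
    rw [Finset.card_erase_of_mem (Finset.mem_univ _), Finset.card_univ]
    simp
    omega
  -- The prescribed points extend to an enumeration of all `N` points; the `0` in `Sum.elim f 0` is
  -- a dummy value outside the prescribed set.
  obtain ⟨g, hg⟩ := Finset.exists_equiv_extend_of_card_eq hT
    (s := Finset.univ.image Sum.inl) (f := Sum.elim f 0)
    (by
      intro v hv
      simp only [Finset.mem_image, Finset.mem_univ, true_and] at hv
      obtain ⟨_, ⟨b, rfl⟩, rfl⟩ := hv
      exact Finset.mem_erase.mpr ⟨hf0 b, Finset.mem_univ _⟩)
    (by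
      intro x hx y hy hxy
      simp only [Finset.coe_image, Finset.coe_univ, Set.image_univ, Set.mem_range] at hx hy
      obtain ⟨b, rfl⟩ := hx
      obtain ⟨b', rfl⟩ := hy
      rw [hf hxy])
  let e : Fin N ≃ ((Fin p ⊕ Fin p) ⊕ Fin 1) ⊕ Fin (N - (p + p + 1)) :=
    (((((finSumFinEquiv.sumCongr (Equiv.refl _)).trans finSumFinEquiv).sumCongr
      (Equiv.refl _)).trans finSumFinEquiv).trans (finCongr (by omega))).symm
  let pt : ℕ → Fin p → ZMod 2 := fun k => g (e ⟨k % N, Nat.mod_lt _ hNpos⟩)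
  have hpt : ∀ k, pt k ≠ 0 := fun k => Finset.ne_of_mem_erase (g _).2
  have hidx : ∀ b, pt (colEquiv hpq hn (Sum.inl b)) = f b := by
    intro b
    have hlt : (colEquiv hpq hn (Sum.inl b) : ℕ) < N := by
      refine lt_of_lt_of_le ?_ hle
      simp only [colEquiv, Equiv.trans_apply, Equiv.sumCongr_apply, Sum.map_inl,
        finSumFinEquiv_apply_left, finCongr_apply, Fin.val_cast, Fin.val_castAdd]
      exact Fin.is_lt _
    have he : e ⟨(colEquiv hpq hn (Sum.inl b) : ℕ) % N, Nat.mod_lt _ hNpos⟩ = Sum.inl b := by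
      rw [Equiv.symm_apply_eq]
      ext
      simp only [Nat.mod_eq_of_lt hlt]
      simp [colEquiv]
    change ((g (e _) : T) : Fin p → ZMod 2) = _
    rw [he]
    exact hg _ (Finset.mem_image_of_mem _ (Finset.mem_univ _))
  let X : Matrix (Fin p) (Fin (q - p)) (ZMod 2) :=
    Matrix.of fun i j => pt (colEquiv hpq hn (Sum.inr j)) i
  have hcol : ∀ c, (upperPart p q X).col c = pt (colEquiv hpq hn c) := by
    rintro (b | j)
    · rw [hidx]
      rfl
    · rfl
  refine ⟨X, (isAdmissible_iff X).mpr ⟨fun j => hpt _, fun v hv => ?_⟩⟩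
  set k := e.symm (g.symm ⟨v, Finset.mem_erase.mpr ⟨hv, Finset.mem_univ _⟩⟩) with hk
  have hptv : ∀ i, pt i = v ↔ i ≡ k [MOD N] := by
    intro i
    have h1 : pt i = v ↔ (⟨i % N, Nat.mod_lt _ hNpos⟩ : Fin N) = k := by
      rw [hk, Equiv.eq_symm_apply, Equiv.eq_symm_apply, Subtype.ext_iff]
    rw [h1, Fin.ext_iff, Nat.ModEq, Nat.mod_eq_of_lt k.2]
  -- In the cyclic list a point occupies one residue class modulo `N`, which meets the first `n`
  -- positions `⌊n / N⌋` or `⌊n / N⌋ + 1` times.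
  have hcount : (Finset.univ.filter fun c => (upperPart p q X).col c = v).card =
      n.count (· ≡ k [MOD N]) := by
    rw [Nat.count_eq_card_filter_range]
    refine Finset.card_bij (fun c _ => (colEquiv hpq hn c : ℕ)) ?_ ?_ ?_
    · intro c hc
      simp only [Finset.mem_filter, Finset.mem_univ, true_and, hcol, hptv] at hc
      simpa using hc
    · intro c _ c' _ h
      exact (colEquiv hpq hn).injective (Fin.ext h)
    · intro i hi
      simp only [Finset.mem_filter, Finset.mem_range] at hi
      refine ⟨(colEquiv hpq hn).symm ⟨i, hi.1⟩, ?_, by simp⟩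
      simpa [hcol, hptv] using hi.2
  rw [hcount, Nat.count_modEq_card _ hNpos]
  split
  · exact Or.inr rfl
  · exact Or.inl rfl

end Counting

end RowColumn

theorem theorem8 (p q n : ℕ) (hp : 3 ≤ p) (hpq : p ≤ q) (hn : n = p + q + 1) :
    (∃ X : Matrix (Fin p) (Fin (q - p)) (ZMod 2), RowColumn.IsAdmissible p q n X) ∧
    ∀ X : Matrix (Fin p) (Fin (q - p)) (ZMod 2), RowColumn.IsAdmissible p q n X →
      LinearIndependent (ZMod 2) (RowColumn.generator hpq hn X).row ∧
      RowColumn.IsFractionalFactorial 1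
        (RowColumn.generatedBy (RowColumn.generator hpq hn X)) ∧
      RowColumn.IsTwoFiOptimal (RowColumn.generatedBy (RowColumn.generator hpq hn X)) ∧
      RowColumn.twoFiEfficiency (RowColumn.generatedBy (RowColumn.generator hpq hn X)) = 1 := by
  refine ⟨RowColumn.exists_isAdmissible hp hpq hn, fun X hX => ?_⟩
  have hli := RowColumn.generator_linearIndependent X hpq hn
  have hff := RowColumn.isFractionalFactorial_one _ hli hn
  have hmain := RowColumn.mainUnconfounded_generator X hp hpq hn hX.1
  have hge := RowColumn.phi_le_numUnconfounded_generator hp hpq hn X hX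
  have hpos : (0 : ℚ) < RowColumn.numUnconfounded
      (RowColumn.generatedBy (RowColumn.generator hpq hn X)) := by
    exact_mod_cast RowColumn.numUnconfounded_generator_pos hp hpq hn X
  have hp0 : 0 < p := by omega
  refine ⟨hli, hff, ⟨hff.1, hmain, fun d' _ hd' => ?_⟩, ?_⟩
  · exact_mod_cast (RowColumn.numUnconfounded_le_phi hp0 hpq d' hd').trans hge
  · have := RowColumn.numUnconfounded_le_phi hp0 hpq _ hmain
    rw [RowColumn.twoFiEfficiency, ← le_antisymm this hge]
    exact div_self hpos.ne'
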